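/- Let $k \ge 2$ be an integer, let $\Sigma$ be a totally ordered alphabet, and let $\mathbf{x} = a_0 a_1 a_2 \cdots$ be a $k$-automatic sequence over $\Sigma$; that is, there is a deterministic finite automaton with outputs associated with its states which, on reading the base-$k$ representation of $n$, reaches a state with output $a_n$, for every $n \ge 0$. Write $\mathbf{x}[i..n-1] = a_i a_{i+1} \cdots a_{n-1}$, and order finite words lexicographically, a proper prefix of a word being smaller than the word. A Lyndon word is a nonempty word that is not of the form $y^m$ with $m \ge 2$ and is lexicographically least among its conjugates. The Lyndon factorization of a nonempty finite word $w$ is the unique way to write $w = w_1 w_2 \cdots w_m$ with Lyndon words $w_1 \ge w_2 \ge \cdots \ge w_m$. Let $(n,i)_k$ be the word over $\{0,\dots,k-1\}^2$ obtained by reading in parallel the base-$k$ representations of $n$ and $i$ (most significant digit first, without leading zeros), the shorter one padded with leading zeros to the length of the longer one. Then there is a finite automaton $A$ over the alphabet $\{0,\dots,k-1\}^2$ that accepts exactly the set of words $$\{ (n,i)_k : n \ge 1,\ \text{the Lyndon factorization of } \mathbf{x}[0..n-1] \text{ is } w_1 w_2 \cdots w_m \text{ with } w_m = \mathbf{x}[i..n-1]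 \}.$$ -/

import Mathlib

namespace LyndonAutomatic

/-- A nonempty word is primitive if it is not of the form `y ^ m` with `m ≥ 2`. -/
def IsPrimitive {α : Type*} (w : List α) : Prop :=
  w ≠ [] ∧ ∀ (y : List α) (m : ℕ), 2 ≤ m → w ≠ (List.replicate m y).flatten

/-- A word is Lyndon if it is primitive and lexicographically least among its conjugates. The
order on `List α` is the usual lexicographic order, in which a proper prefix of a word is
smaller than the word. -/
def IsLyndon {α : Type*} [LinearOrder α] (w : List α) : Prop :=
  IsPrimitive w ∧ ∀ u v : List α, w = u ++ v → w ≤ v ++ u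

/-- `L = [w₁, …, wₘ]` is a Lyndon factorization of `w`: each `wⱼ` is a Lyndon word,
`w = w₁ w₂ ⋯ wₘ` and `w₁ ≥ w₂ ≥ ⋯ ≥ wₘ`. -/
structure IsLyndonFactorization {α : Type*} [LinearOrder α]
    (L : List (List α)) (w : List α) : Prop where
  flatten_eq : L.flatten = w
  lyndon : ∀ u ∈ L, IsLyndon u
  nonincreasing : L.Pairwise (fun u v => v ≤ u)

/-- The word `x[i..n-1] = x i, x (i+1), …, x (n-1)`; it is empty if `n ≤ i`. -/
def block {α : Type*} (x : ℕ → α) (i n : ℕ) : List α :=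
  (List.range' i (n - i)).map x

/-- The natural number denoted by a word of base-`k` digits, most significant digit first. -/
def value (k : ℕ) (w : List (Fin k)) : ℕ :=
  Nat.ofDigits k (w.map Fin.val).reverse

/-- `w` is the base-`k` representation of `n`: most significant digit first, without leading
zeros (so that `0` is represented by the empty word). -/
def IsRep (k : ℕ) (w : List (Fin k)) (n : ℕ) : Prop :=
  value k w = n ∧ ∀ d ∈ w.head?, (d : ℕ) ≠ 0

/-- `w` is the base-`k` representation `(n, i)_k` of the pair `(n, i)`: the representations of `n`
and `i`, the shorter one padded with leading zeros to the length of the longer one, are read in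
parallel as one word of pairs of digits, whose first letter is not the pair of two zeros. -/
def IsPairRep (k : ℕ) (w : List (Fin k × Fin k)) (n i : ℕ) : Prop :=
  value k (w.map Prod.fst) = n ∧ value k (w.map Prod.snd) = i ∧
    ∀ d ∈ w.head?, ¬ ((d.1 : ℕ) = 0 ∧ (d.2 : ℕ) = 0)

/-- A deterministic automaton over `A` with outputs in `α` associated with its states `σ`. -/
structure DFAO (A α σ : Type*) where
  step : σ → A → σ
  start : σ
  output : σ → α

/-- The state reached from the start state after reading the word `w` from left to right. -/
def DFAO.eval {A α σ : Type*} (M : DFAO A α σ) (w : List A) : σ :=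
  w.foldl M.step M.start

/-- `x` is `k`-automatic: some finite automaton with output, reading the base-`k` representation
of `n`, reaches a state with output `x n`, for every `n`. -/
def IsAutomatic {α : Type*} (k : ℕ) (x : ℕ → α) : Prop :=
  ∃ (σ : Type) (_ : Finite σ) (M : DFAO (Fin k) α σ),
    ∀ (n : ℕ) (w : List (Fin k)), IsRep k w n → M.output (M.eval w) = x n

/-- The set of words `(n, i)_k` such that the Lyndon factorization `w₁ w₂ ⋯ wₘ` of `x[0..n-1]`
has the last term `wₘ = x[i..n-1]`. -/
def lastTermLanguage {α : Type*} [LinearOrder α] (k : ℕ) (x : ℕ → α) :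
    Language (Fin k × Fin k) :=
  {w | ∃ n i : ℕ, IsPairRep k w n i ∧ ∃ L : List (List α),
    IsLyndonFactorization L (block x 0 n) ∧ L.getLast? = some (block x i n)}

end LyndonAutomatic

/-! The last Lyndon factor of a word is its least nonempty suffix
(`exists_factorization_getLast_iff`): a nonincreasing Lyndon factorization forces this, and
conversely stripping off least suffixes repeatedly builds such a factorization. Two suffixes of
x[0..n-1] are compared at their first mismatch, so the condition on (n, i) becomes a first-order
formula over ℕ whose atoms are inequalities, additions and relations between letters of x
(`exists_factorization_block_iff`).

Such formulas define regular languages. The atoms are handled by `isDigitRecognizable_lt`,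
`isDigitRecognizable_add_eq_add` and `IsAutomatic.isDigitRecognizable_rel`; connectives and
quantifiers preserve recognizability (`IsDigitRecognizable.exists_update` is the subset
construction). Recognizability is stated for tuples of numbers rather than digit words, so padding
plays no role in these closure arguments; `isRegular_head_not` restores canonical representations at
the end. -/

namespace LyndonAutomatic

/-! ### Predicates recognizable by reading digits, and their closure properties -/

section Recognizable

/-- A predicate on families of natural numbers is digit-recognizable in base `k` if it factors
through a map to a finite type that is compatible with appending a digit to every entry. -/
def IsDigitRecognizable (k : ℕ) {ι : Type*} (S : (ι → ℕ) → Prop) : Prop :=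
  ∃ (Q : Type) (_ : Finite Q) (f : (ι → ℕ) → Q) (step : Q → (ι → Fin k) → Q) (P : Q → Prop),
    (∀ v r, f (fun j => k * v j + r j) = step (f v) r) ∧ ∀ v, S v ↔ P (f v)

namespace IsDigitRecognizable

variable {k : ℕ} {ι : Type*} {S T : (ι → ℕ) → Prop}

theorem not (hS : IsDigitRecognizable k S) : IsDigitRecognizable k (fun v => ¬ S v) := by
  obtain ⟨Q, hQ, f, step, P, hf, hP⟩ := hS
  exact ⟨Q, hQ, f, step, fun q => ¬ P q, hf, fun v => not_congr (hP v)⟩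

theorem and (hS : IsDigitRecognizable k S) (hT : IsDigitRecognizable k T) :
    IsDigitRecognizable k (fun v => S v ∧ T v) := by
  obtain ⟨Q, hQ, f, step, P, hf, hP⟩ := hS
  obtain ⟨Q', hQ', f', step', P', hf', hP'⟩ := hT
  exact ⟨Q × Q', inferInstance, fun v => (f v, f' v), fun q r => (step q.1 r, step' q.2 r),
    fun q => P q.1 ∧ P' q.2, fun v r => by simp [hf, hf'], fun v => and_congr (hP v) (hP' v)⟩

theorem imp (hS : IsDigitRecognizable k S) (hT : IsDigitRecognizable k T) :
    IsDigitRecognizable k (fun v => S v → T v) := by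
  have h := (hS.and hT.not).not
  simpa only [not_and, not_not] using h

/-- Subset construction: the new state is the set of all states reached as the quantified entry
varies. Already at the zero tuple this set ranges over every `y`, so witnesses longer than the input
need no separate treatment. -/
theorem exists_update [DecidableEq ι] (hk : 0 < k) (hS : IsDigitRecognizable k S) (i : ι) :
    IsDigitRecognizable k (fun v => ∃ y, S (Function.update v i y)) := by
  obtain ⟨Q, hQ, f, step, P, hf, hP⟩ := hS
  refine ⟨Set Q, inferInstance, fun v => Set.range fun y => f (Function.update v i y),
    fun A r => {q | ∃ p ∈ A, ∃ c, q = step p (Function.update r i c)},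
    fun A => ∃ q ∈ A, P q, fun v r => ?_, fun v => ?_⟩
  · have key : ∀ (y : ℕ) (c : Fin k),
        f (Function.update (fun j => k * v j + (r j : ℕ)) i (k * y + c)) =
          step (f (Function.update v i y)) (Function.update r i c) := by
      intro y c
      rw [← hf]
      congr 1
      funext j
      by_cases hj : j = i
      · subst hj; simp
      · simp [hj]
    ext q
    constructor
    · rintro ⟨y, rfl⟩
      -- The witness is split into its last digit and the number formed by the others.
      refine ⟨_, ⟨y / k, rfl⟩, ⟨y % k, Nat.mod_lt _ hk⟩, ?_⟩
      rw [← key]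
      simp only [Nat.div_add_mod]
    · rintro ⟨_, ⟨y, rfl⟩, c, rfl⟩
      exact ⟨k * y + c, key y c⟩
  · simp [hP]

theorem forall_update [DecidableEq ι] (hk : 0 < k) (hS : IsDigitRecognizable k S) (i : ι) :
    IsDigitRecognizable k (fun v => ∀ y, S (Function.update v i y)) := by
  have h := (hS.not.exists_update hk i).not
  simpa only [not_exists, not_not] using h

end IsDigitRecognizable

/-- Saturation is permanent: if `d ≥ M` then `k * d + ρ ≥ k * M - (k - 1) * M = M`, and
symmetrically below. A bounded counter therefore suffices to track a linear form digit by digit. -/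
theorem clamp_mul_add (k M d ρ : ℤ) (hk : 1 ≤ k) (hM : 0 ≤ M) (h₁ : -((k - 1) * M) ≤ ρ)
    (h₂ : ρ ≤ (k - 1) * M) :
    max (-M) (min M (k * d + ρ)) = max (-M) (min M (k * max (-M) (min M d) + ρ)) := by
  rcases le_total M d with h | h
  · rw [min_eq_left h, max_eq_right (by omega : -M ≤ M), min_eq_left (by nlinarith),
      min_eq_left (by nlinarith)]
  · rcases le_total d (-M) with h' | h'
    · rw [min_eq_right h, max_eq_left h', max_eq_left, max_eq_left]
      · exact (min_le_right _ _).trans (by nlinarith)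
      · exact (min_le_right _ _).trans (by nlinarith)
    · rw [min_eq_right h, max_eq_right h']

/-- A sign condition on `v a + v b - v c - v d` is digit-recognizable. -/
theorem isDigitRecognizable_sign {k : ℕ} (hk : 0 < k) {ι : Type*} (a b c d : ι) (P : ℤ → Prop)
    (hP : ∀ m : ℤ, P m ↔ P (max (-2) (min 2 m))) :
    IsDigitRecognizable k fun v => P ((v a : ℤ) + v b - v c - v d) := by
  -- The bound is 2 because two digits minus two digits lies between `-2 * (k - 1)` and `2 * (k -
  -- 1)`.
  let clamp : ℤ → Set.Icc (-2 : ℤ) 2 := fun m => ⟨max (-2) (min 2 m), by simp⟩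
  refine ⟨Set.Icc (-2 : ℤ) 2, inferInstance, fun v => clamp ((v a : ℤ) + v b - v c - v d),
    fun q r => clamp (k * q + ((r a : ℤ) + r b - r c - r d)), fun q => P q, fun v r => ?_,
    fun v => hP _⟩
  have ha := (r a).isLt
  have hb := (r b).isLt
  have hc := (r c).isLt
  have hd := (r d).isLt
  apply Subtype.ext
  have h := clamp_mul_add k 2 ((v a : ℤ) + v b - v c - v d)
    ((r a : ℤ) + r b - r c - r d) (by omega) (by omega) (by omega) (by omega)
  simp only [clamp]
  rw [← h]
  push_cast
  congr 2
  ring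

theorem isDigitRecognizable_add_eq_add {k : ℕ} (hk : 0 < k) {ι : Type*} (a b c d : ι) :
    IsDigitRecognizable k fun v => v a + v b = v c + v d := by
  have h := isDigitRecognizable_sign hk a b c d (fun m => m = 0) (fun m => by omega)
  convert h using 3
  omega

theorem isDigitRecognizable_lt {k : ℕ} (hk : 0 < k) {ι : Type*} (a c : ι) :
    IsDigitRecognizable k fun v => v a < v c := by
  -- Repeating both coordinates only doubles the difference, which keeps its sign.
  have h := isDigitRecognizable_sign hk a a c c (fun m => m < 0) (fun m => by omega)
  convert h using 3
  omega

theorem value_append_singleton (k : ℕ) (w : List (Fin k)) (d : Fin k) :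
    value k (w ++ [d]) = k * value k w + d := by
  simp [value, Nat.ofDigits_cons, add_comm]

theorem IsRep.append_singleton {k : ℕ} {w : List (Fin k)} {n : ℕ} (hw : IsRep k w n) (d : Fin k)
    (h : ¬ (n = 0 ∧ (d : ℕ) = 0)) : IsRep k (w ++ [d]) (k * n + d) := by
  refine ⟨by rw [value_append_singleton, hw.1], ?_⟩
  cases w with
  | nil =>
    have h0 : n = 0 := by rw [← hw.1]; simp [value]
    simpa [h0] using h
  | cons e w => simpa using hw.2

/-- The canonical base-`k` representation of `n`, most significant digit first. -/
def digitWord (k n : ℕ) [NeZero k] : List (Fin k) :=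
  ((Nat.digits k n).map (Fin.ofNat k)).reverse

theorem digitWord_mul_add {k : ℕ} [NeZero k] (hk : 2 ≤ k) {n : ℕ} {d : Fin k}
    (h : ¬ (n = 0 ∧ (d : ℕ) = 0)) : digitWord k (k * n + d) = digitWord k n ++ [d] := by
  rw [digitWord, add_comm, Nat.digits_add k hk _ _ d.isLt (by omega)]
  simp [digitWord]

theorem isRep_digitWord {k : ℕ} [NeZero k] (hk : 2 ≤ k) (n : ℕ) : IsRep k (digitWord k n) n := by
  induction n using Nat.strong_induction_on with
  | _ n ih =>
    rcases Nat.eq_zero_or_pos n with rfl | hn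
    · simp [IsRep, value, digitWord]
    · have hd : n % k < k := Nat.mod_lt _ (by omega)
      have hdiv := Nat.div_add_mod n k
      have h : ¬ (n / k = 0 ∧ ((⟨n % k, hd⟩ : Fin k) : ℕ) = 0) := by
        rintro ⟨h₁, h₂⟩
        simp only at h₂
        rw [h₁, h₂] at hdiv
        omega
      have := (ih (n / k) (Nat.div_lt_self hn hk)).append_singleton _ h
      rw [← digitWord_mul_add hk h] at this
      simpa only [hdiv] using this

/-- An automatic sequence is the image of a finite-state sequence whose states are updated by
appending a digit, also when leading zeros are present. -/
theorem IsAutomatic.exists_state {α : Type*} {k : ℕ} [NeZero k] (hk : 2 ≤ k) {x : ℕ → α}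
    (hx : IsAutomatic k x) :
    ∃ (Q : Type) (_ : Finite Q) (s : ℕ → Q) (step : Q → Fin k → Q) (out : Q → α),
      (∀ (n : ℕ) (d : Fin k), s (k * n + d) = step (s n) d) ∧ ∀ n, x n = out (s n) := by
  obtain ⟨σ, hσ, M, hM⟩ := hx
  -- `M` is constrained only on words without leading zeros, so the extra state `none` stands for
  -- the number 0 and absorbs zero digits.
  refine ⟨Option σ, inferInstance, fun n => if n = 0 then none else some (M.eval (digitWord k n)),
    fun q d => if q = none ∧ (d : ℕ) = 0 then none else some (M.step (q.getD M.start) d),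
    fun q => M.output (q.getD M.start), fun n d => ?_, fun n => ?_⟩
  · by_cases h : n = 0 ∧ (d : ℕ) = 0
    · simp [h.1, h.2]
    · have h' : ¬ k * n + (d : ℕ) = 0 := by
        rintro h'
        have : k * n = 0 := by omega
        exact h ⟨by simpa [show k ≠ 0 by omega] using this, by omega⟩
      simp only [if_neg h']
      rw [digitWord_mul_add hk h]
      by_cases hn : n = 0
      · have hd : (d : ℕ) ≠ 0 := fun hd => h ⟨hn, hd⟩
        simp [hn, hd, DFAO.eval, digitWord]
      · simp [hn, DFAO.eval]
  · rw [← hM n _ (isRep_digitWord hk n)]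
    by_cases hn : n = 0
    · simp [hn, DFAO.eval, digitWord]
    · simp [hn]

theorem IsAutomatic.isDigitRecognizable_rel {α : Type*} {k : ℕ} (hk : 2 ≤ k) {x : ℕ → α}
    (hx : IsAutomatic k x) {ι : Type*} (R : α → α → Prop) (a b : ι) :
    IsDigitRecognizable k fun v => R (x (v a)) (x (v b)) := by
  have : NeZero k := ⟨by omega⟩
  obtain ⟨Q, hQ, s, step, out, hs, hout⟩ := hx.exists_state hk
  exact ⟨Q × Q, inferInstance, fun v => (s (v a), s (v b)),
    fun q r => (step q.1 (r a), step q.2 (r b)), fun q => R (out q.1) (out q.2),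
    fun v r => by simp [hs], fun v => by simp [hout]⟩

/-- The words over pairs of digits whose values satisfy a digit-recognizable predicate form a
regular language. The entries other than `a` and `b` are set to zero. -/
theorem IsDigitRecognizable.isRegular {k : ℕ} [NeZero k] {ι : Type*} [DecidableEq ι]
    {S : (ι → ℕ) → Prop} (hS : IsDigitRecognizable k S) (a b : ι) :
    Language.IsRegular ({w | S (Function.update (Function.update 0 a (value k (w.map Prod.fst))) b
      (value k (w.map Prod.snd)))} : Language (Fin k × Fin k)) := by
  obtain ⟨Q, hQ, f, step, P, hf, hP⟩ := hS
  have := Fintype.ofFinite Q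
  let A : DFA (Fin k × Fin k) Q :=
    ⟨fun q d => step q (Function.update (Function.update 0 a d.1) b d.2), f 0, {q | P q}⟩
  have hA : ∀ w, A.eval w = f (Function.update (Function.update 0 a (value k (w.map Prod.fst))) b
      (value k (w.map Prod.snd))) := by
    intro w
    induction w using List.reverseRecOn with
    | nil => simp [A, value, DFA.eval, DFA.evalFrom]
    | append_singleton w d ih =>
      rw [DFA.eval_append_singleton, ih]
      simp only [A, ← hf, List.map_append, List.map_singleton, value_append_singleton]
      congr 1
      funext j
      by_cases hb : j = b
      · subst hb; simp
      · by_cases ha : j = a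
        · subst ha; simp [hb]
        · simp [ha, hb]
  refine ⟨Q, inferInstance, A, ?_⟩
  ext w
  rw [DFA.mem_accepts, hA]
  exact (hP _).symm

theorem isRegular_head_not {β : Type*} (p : β → Prop) :
    Language.IsRegular ({w | ∀ d ∈ w.head?, ¬ p d} : Language β) := by
  classical
  -- The first letter fixes the verdict and later letters keep it; the default `True` accepts the
  -- empty word.
  let A : DFA β (Option Prop) := ⟨fun q d => some (q.getD (¬ p d)), none, {q | q.getD True}⟩
  have hA : ∀ (w : List β) (q : Prop), A.evalFrom (some q) w = some q := by
    intro w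
    induction w with
    | nil => simp
    | cons d w ih => intro q; simpa [A, DFA.evalFrom] using ih q
  refine ⟨Option Prop, inferInstance, A, ?_⟩
  ext w
  rw [DFA.mem_accepts]
  change _ ↔ ∀ d ∈ w.head?, ¬ p d
  cases w with
  | nil => simp [A]
  | cons d w =>
    have h : A.eval (d :: w) = some (¬ p d) := hA w _
    rw [h]
    simp [A]

end Recognizable

/-! ### Lyndon words, least suffixes and the comparison of suffixes -/

section Words

variable {α : Type*}

/-- Euclid's algorithm on lengths: the shorter word is a prefix of the longer, and cancelling it
leaves a shorter commuting pair. -/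
theorem exists_replicate_of_append_comm (u v : List α) (h : u ++ v = v ++ u) :
    ∃ (z : List α) (m n : ℕ), u = (List.replicate m z).flatten ∧
      v = (List.replicate n z).flatten := by
  induction hn : u.length + v.length using Nat.strong_induction_on generalizing u v with
  | _ N ih =>
    wlog huv : u.length ≤ v.length generalizing u v
    · obtain ⟨z, m, n, h₁, h₂⟩ := this v u h.symm (by omega) (by omega)
      exact ⟨z, n, m, h₂, h₁⟩
    rcases eq_or_ne u [] with rfl | hu
    · exact ⟨v, 0, 1, by simp, by simp⟩
    · obtain ⟨t, rfl⟩ : u <+: v :=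
        List.prefix_of_prefix_length_le ⟨v, rfl⟩ ⟨u, h.symm⟩ huv
      have hpos := List.length_pos_iff.2 hu
      obtain ⟨z, m, n, h₁, h₂⟩ := ih (u.length + t.length) (by simp at hn; omega) u t
        (by simpa using h) rfl
      refine ⟨z, m, m + n, h₁, ?_⟩
      rw [List.replicate_add, List.flatten_append, ← h₁, ← h₂]

theorem block_of_lt (x : ℕ → α) {i n : ℕ} (h : i < n) : block x i n = x i :: block x (i + 1) n := by
  obtain ⟨m, rfl⟩ : ∃ m, n = i + (m + 1) := ⟨n - i - 1, by omega⟩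
  simp [block, show i + (m + 1) - i = m + 1 by omega, show i + (m + 1) - (i + 1) = m by omega,
    List.range'_succ]

theorem block_of_le (x : ℕ → α) {i n : ℕ} (h : n ≤ i) : block x i n = [] := by
  simp [block, Nat.sub_eq_zero_of_le h]

theorem block_ne_nil_iff (x : ℕ → α) {i n : ℕ} : block x i n ≠ [] ↔ i < n := by
  rcases lt_or_ge i n with h | h
  · simp [block_of_lt x h, h]
  · simp [block_of_le x h, h]

theorem suffix_block_iff (x : ℕ → α) {n : ℕ} {t : List α} (ht : t ≠ []) {i : ℕ} :
    t <:+ block x i n ↔ ∃ j, i ≤ j ∧ j < n ∧ t = block x j n := by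
  induction hd : n - i generalizing i with
  | zero =>
    rw [block_of_le x (by omega), List.suffix_nil]
    constructor
    · exact fun h => absurd h ht
    · rintro ⟨j, h₁, h₂, -⟩
      omega
  | succ d ih =>
    rw [block_of_lt x (by omega), List.suffix_cons_iff, ih (by omega), ← block_of_lt x (by omega)]
    constructor
    · rintro (rfl | ⟨j, h₁, h₂, rfl⟩)
      · exact ⟨i, le_rfl, by omega, rfl⟩
      · exact ⟨j, by omega, h₂, rfl⟩
    · rintro ⟨j, h₁, h₂, rfl⟩
      rcases h₁.eq_or_lt with rfl | h₁
      · exact Or.inl rfl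
      · exact Or.inr ⟨j, h₁, h₂, rfl⟩

variable [LinearOrder α]

theorem nil_le_word (u : List α) : [] ≤ u := not_lt.1 (List.not_lt_nil u)

theorem cons_le_cons_iff_lt_or {a b : α} {u v : List α} :
    a :: u ≤ b :: v ↔ a < b ∨ a = b ∧ u ≤ v := by
  rw [← not_lt, ← not_lt (a := v)]
  refine (not_congr List.cons_lt_cons_iff).trans ?_
  rcases lt_trichotomy a b with h | rfl | h
  · simp [h, h.not_gt, h.ne']
  · simp
  · simp [h, h.not_gt, h.ne']

theorem append_lt_append_of_lt {u v : List α} (h : u < v) (hp : ¬ u <+: v) (s t : List α) :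
    u ++ s < v ++ t := by
  induction u generalizing v with
  | nil => simp at hp
  | cons a u ih =>
    cases v with
    | nil => exact absurd h (List.not_lt_nil _)
    | cons b v =>
      refine List.cons_lt_cons_iff.2 ?_
      rcases List.cons_lt_cons_iff.1 h with h | ⟨rfl, h₂⟩
      · exact Or.inl h
      · exact Or.inr ⟨rfl, ih h₂ (by simpa using hp)⟩

theorem append_le_append_left_iff {u v w : List α} : u ++ v ≤ u ++ w ↔ v ≤ w := by
  induction u with
  | nil => simp
  | cons a u ih => simpa [cons_le_cons_iff_lt_or] using ih

theorem le_append_right (u v : List α) : u ≤ u ++ v := by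
  simpa using (append_le_append_left_iff (u := u)).2 (nil_le_word v)

theorem append_lt_append_of_lt_of_length_eq {u v : List α} (h : u < v)
    (hl : u.length = v.length) (s t : List α) : u ++ s < v ++ t :=
  append_lt_append_of_lt h (fun hp => h.ne (hp.eq_of_length hl)) s t

/-- `s` is the lexicographically least nonempty suffix of `w`. -/
def IsLeastSuffix (s w : List α) : Prop :=
  s ≠ [] ∧ s <:+ w ∧ ∀ t, t <:+ w → t ≠ [] → s ≤ t

theorem exists_isLeastSuffix {w : List α} (hw : w ≠ []) : ∃ s, IsLeastSuffix s w := by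
  obtain ⟨s, hs, hmin⟩ := (w.tails.toFinset.filter (· ≠ [])).exists_min_image id
    ⟨w, by simp [hw]⟩
  simp only [Finset.mem_filter, List.mem_toFinset, List.mem_tails, id] at hs hmin
  exact ⟨s, hs.2, hs.1, fun t ht h => hmin t ⟨ht, h⟩⟩

theorem IsLyndon.ne_nil {w : List α} (hw : IsLyndon w) : w ≠ [] := hw.1.1

/-- Suppose `w = u ++ v` and `v < w`. If `v` is not a prefix of `w`, the mismatch makes the
conjugate `v ++ u` smaller than `w`. Otherwise `w = v ++ t`; minimality against `v ++ u` and `t ++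
v` gives `t = u`, so `u` and `v` commute and `w` is a proper power. -/
theorem IsLyndon.isLeastSuffix {w : List α} (hw : IsLyndon w) : IsLeastSuffix w w := by
  refine ⟨hw.ne_nil, List.suffix_rfl, ?_⟩
  rintro v ⟨u, rfl⟩ hv
  rcases eq_or_ne u [] with rfl | hu
  · simp
  by_contra! hlt
  by_cases hp : v <+: u ++ v
  · obtain ⟨t, ht⟩ := hp
    have hlen : t.length = u.length := by
      have := congrArg List.length ht
      simp at this
      omega
    have h₁ : u ++ v ≤ v ++ u := hw.2 u v rfl
    have h₂ : u ++ v ≤ t ++ v := hw.2 v t ht.symm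
    have htu : t ≤ u := append_le_append_left_iff.1 (ht ▸ h₁)
    have hut : u ≤ t := by
      by_contra! h
      exact absurd h₂ (append_lt_append_of_lt_of_length_eq h hlen v v).not_ge
    obtain rfl : t = u := le_antisymm htu hut
    obtain ⟨z, m, n, rfl, rfl⟩ := exists_replicate_of_append_comm t v ht.symm
    refine hw.1.2 z (m + n) ?_ (by rw [List.replicate_add, List.flatten_append])
    have hm : m ≠ 0 := by rintro rfl; simp at hu
    have hn : n ≠ 0 := by rintro rfl; simp at hv
    omega
  · have h := append_lt_append_of_lt hlt hp u []
    rw [List.append_nil] at h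
    exact absurd (hw.2 u v rfl) h.not_ge

/-- A proper power would have its root as a smaller suffix, and a conjugate `v ++ u` with `v`
nonempty is at least the suffix `v`. -/
theorem IsLeastSuffix.isLyndon {s w : List α} (h : IsLeastSuffix s w) : IsLyndon s := by
  obtain ⟨hs, hsw, hmin⟩ := h
  refine ⟨⟨hs, ?_⟩, ?_⟩
  · rintro y m hm rfl
    obtain ⟨l, rfl⟩ : ∃ l, m = l + 2 := ⟨m - 2, by omega⟩
    have hy : y ≠ [] := by rintro rfl; simp at hs
    have h₁ := hmin y (List.IsSuffix.trans
      ⟨(List.replicate (l + 1) y).flatten, by rw [List.replicate_succ' (n := l + 1)]; simp⟩ hsw) hy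
    have h₂ : y ++ (List.replicate (l + 1) y).flatten ≤ y ++ [] := by
      simpa [List.replicate_succ] using h₁
    rw [append_le_append_left_iff] at h₂
    have h₃ := le_antisymm h₂ (nil_le_word _)
    simp [List.replicate_succ, hy] at h₃
  · rintro u v rfl
    rcases eq_or_ne v [] with rfl | hv
    · simp
    · exact (hmin v (List.IsSuffix.trans ⟨u, rfl⟩ hsw) hv).trans (le_append_right _ _)

/-- A suffix reaching into the first factor `u` starts with a suffix `v` of `u`; if `v` is nonempty,
then `s ≤ u ≤ v` because `u` is Lyndon. -/
theorem IsLyndonFactorization.isLeastSuffix {L : List (List α)} {w s : List α}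
    (h : IsLyndonFactorization L w) (hs : L.getLast? = some s) : IsLeastSuffix s w := by
  induction L generalizing w with
  | nil => simp at hs
  | cons u L ih =>
    obtain ⟨rfl, hl, hp⟩ := h
    have hu := hl u (by simp)
    rcases eq_or_ne L [] with rfl | hL
    · obtain rfl : u = s := by simpa using hs
      simpa using hu.isLeastSuffix
    · rw [List.getLast?_cons_of_ne_nil hL] at hs
      rw [List.pairwise_cons] at hp
      obtain ⟨h₁, h₂, h₃⟩ := ih ⟨rfl, fun v hv => hl v (by simp [hv]), hp.2⟩ hs
      have hsu : s ≤ u := hp.1 s (List.mem_of_getLast? hs)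
      refine ⟨h₁, h₂.trans ⟨u, by simp⟩, fun t ht ht' => ?_⟩
      rw [List.flatten_cons] at ht
      rcases List.suffix_or_suffix_of_suffix ht ⟨u, rfl⟩ with ht | ⟨v, rfl⟩
      · exact h₃ t ht ht'
      · have hv : v <:+ u := List.suffix_append_self_iff.1 ht
        rcases eq_or_ne v [] with rfl | hv'
        · exact h₃ _ (by simp) ht'
        · exact (hsu.trans (hu.isLeastSuffix.2.2 v hv hv')).trans (le_append_right _ _)

/-- This gives the nonincreasing order when least suffixes are stripped off. Suppose `s' < s`;
minimality gives `s ≤ s' ++ s`, so `s'` must be a prefix of `s`, say `s = s' ++ t`. Cancelling `s'`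
yields `t ≤ s`, while `s ≤ t` since `t` is a suffix; hence `s'` would be empty. -/
theorem IsLeastSuffix.le_of_append {s s' w : List α} (h : IsLeastSuffix s (w ++ s))
    (h' : IsLeastSuffix s' w) : s ≤ s' := by
  by_contra! hlt
  have hss : s ≤ s' ++ s := by
    obtain ⟨t, rfl⟩ := h'.2.1
    exact h.2.2 _ ⟨t, by simp⟩ (by simp [h.1])
  by_cases hp : s' <+: s
  · obtain ⟨t, rfl⟩ := hp
    rw [append_le_append_left_iff] at hss
    have ht : t ≠ [] := by rintro rfl; simp at hlt
    have hst := h.2.2 t ⟨w ++ s', by simp⟩ ht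
    exact h'.1 (by simpa using le_antisymm hss hst)
  · have := append_lt_append_of_lt hlt hp s []
    rw [List.append_nil] at this
    exact absurd hss this.not_ge

theorem IsLeastSuffix.exists_factorization {s w : List α} (h : IsLeastSuffix s w) :
    ∃ L, IsLyndonFactorization L w ∧ L.getLast? = some s := by
  induction hn : w.length using Nat.strong_induction_on generalizing s w with
  | _ N ih =>
    obtain ⟨w', rfl⟩ := h.2.1
    rcases eq_or_ne w' [] with rfl | hw'
    · exact ⟨[s], ⟨by simp, by simpa using h.isLyndon, by simp⟩, by simp⟩
    · obtain ⟨s', hs'⟩ := exists_isLeastSuffix hw'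
      have hpos := List.length_pos_iff.2 h.1
      obtain ⟨L, ⟨rfl, hl, hp⟩, hL⟩ := ih w'.length (by simp at hn; omega) hs' rfl
      have hle := h.le_of_append hs'
      refine ⟨L ++ [s], ⟨by simp, ?_, ?_⟩, by simp⟩
      · intro u hu
        rcases List.mem_append.1 hu with hu | hu
        · exact hl u hu
        · rw [List.mem_singleton.1 hu]
          exact h.isLyndon
      · rw [List.pairwise_append]
        refine ⟨hp, by simp, fun u hu v hv => ?_⟩
        rw [List.mem_singleton.1 hv]
        obtain ⟨L', rfl⟩ := List.getLast?_eq_some_iff.1 hL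
        rw [List.pairwise_append] at hp
        rcases List.mem_append.1 hu with hu | hu
        · exact hle.trans (hp.2.2 u hu s' (by simp))
        · rw [List.mem_singleton.1 hu]
          exact hle

/-- The last term of the Lyndon factorization is the least nonempty suffix. -/
theorem exists_factorization_getLast_iff {s w : List α} :
    (∃ L, IsLyndonFactorization L w ∧ L.getLast? = some s) ↔ IsLeastSuffix s w :=
  ⟨fun ⟨_, hL, hs⟩ => hL.isLeastSuffix hs, IsLeastSuffix.exists_factorization⟩

/-- Comparison of two suffixes `x[i..n-1]` and `x[j..n-1]` at their first difference. -/
theorem block_le_block_iff (x : ℕ → α) {i j n : ℕ} (hij : i < j) (hjn : j ≤ n) :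
    block x i n ≤ block x j n ↔
      ∃ t, j + t < n ∧ x (i + t) < x (j + t) ∧ ∀ s < t, x (i + s) = x (j + s) := by
  induction hd : n - j generalizing i j with
  | zero =>
    -- The second suffix is now empty and the first is not, so both sides fail: the shorter suffix
    -- being a prefix of the longer never favours `i`.
    obtain rfl : n = j := by omega
    simp [block_of_lt x hij, block_of_le x le_rfl]
  | succ d ih =>
    rw [block_of_lt x (by omega : i < n), block_of_lt x (by omega : j < n),
      cons_le_cons_iff_lt_or, ih (by omega) (by omega) (by omega)]
    constructor
    · rintro (h | ⟨h, t, h₁, h₂, h₃⟩)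
      · exact ⟨0, by omega, h, by simp⟩
      · refine ⟨t + 1, by omega, by convert h₂ using 2 <;> omega, fun s hs => ?_⟩
        cases s with
        | zero => exact h
        | succ s => convert h₃ s (by omega) using 2 <;> omega
    · rintro ⟨t, h₁, h₂, h₃⟩
      cases t with
      | zero => exact Or.inl h₂
      | succ t =>
        refine Or.inr ⟨h₃ 0 (by omega), t, by omega, by convert h₂ using 2 <;> omega,
          fun s hs => ?_⟩
        convert h₃ (s + 1) (by omega) using 2 <;> omega

/-- For `i < j ≤ n`, the suffix `x[i..n-1]` precedes `x[j..n-1]`: the letters at some positions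
`a` and `b` of the same offset are the first to differ. -/
def SuffixPrecedes (x : ℕ → α) (i j n : ℕ) : Prop :=
  ∃ a b, b < n ∧ ¬ b < j ∧ a + j = b + i ∧ x a < x b ∧
    ∀ c d, d < b ∧ ¬ d < j ∧ c + j = d + i → x c = x d

/-- Replacing the offset by absolute positions, with `a - i = b - j` written additively, leaves only
atoms known to be recognizable. -/
theorem block_le_block_iff_suffixPrecedes (x : ℕ → α) {i j n : ℕ} (hij : i < j) (hjn : j ≤ n) :
    block x i n ≤ block x j n ↔ SuffixPrecedes x i j n := by
  rw [block_le_block_iff x hij hjn]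
  constructor
  · rintro ⟨t, h₁, h₂, h₃⟩
    refine ⟨i + t, j + t, h₁, by omega, by omega, h₂, ?_⟩
    rintro c d ⟨h₄, h₅, h₆⟩
    convert h₃ (d - j) (by omega) using 2 <;> omega
  · rintro ⟨a, b, h₁, h₂, h₃, h₄, h₅⟩
    refine ⟨b - j, by omega, by convert h₄ using 2 <;> omega, fun s hs => ?_⟩
    exact h₅ _ _ ⟨by omega, by omega, by omega⟩

/-- The last term of the Lyndon factorization of `x[0..n-1]`, described by comparing letters. -/
theorem exists_factorization_block_iff (x : ℕ → α) {n i : ℕ} :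
    (∃ L, IsLyndonFactorization L (block x 0 n) ∧ L.getLast? = some (block x i n)) ↔
      i < n ∧ ∀ j, (i < j ∧ j < n → SuffixPrecedes x i j n) ∧
        (j < i → ¬ SuffixPrecedes x j i n) := by
  rw [exists_factorization_getLast_iff, IsLeastSuffix, block_ne_nil_iff]
  refine and_congr_right fun hin => ?_
  rw [suffix_block_iff x ((block_ne_nil_iff x).2 hin)]
  refine (and_iff_right ⟨i, by omega, hin, rfl⟩).trans ?_
  constructor
  · intro h j
    have hle : j < n → block x i n ≤ block x j n := fun hjn => by
      have hj := (block_ne_nil_iff x).2 hjn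
      exact h _ ((suffix_block_iff x hj).2 ⟨j, by omega, hjn, rfl⟩) hj
    refine ⟨fun ⟨hij, hjn⟩ => (block_le_block_iff_suffixPrecedes x hij hjn.le).1 (hle hjn),
      fun hji hp => ?_⟩
    have h' := (block_le_block_iff_suffixPrecedes x hji hin.le).2 hp
    have := congrArg List.length (le_antisymm h' (hle (by omega)))
    simp [block] at this
    omega
  · intro h t ht ht'
    obtain ⟨j, -, hjn, rfl⟩ := (suffix_block_iff x ht').1 ht
    rcases lt_trichotomy i j with hij | rfl | hij
    · exact (block_le_block_iff_suffixPrecedes x hij hjn.le).2 ((h j).1 ⟨hij, hjn⟩)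
    · exact le_rfl
    · refine le_of_not_ge fun hle => ?_
      exact (h j).2 hij ((block_le_block_iff_suffixPrecedes x hij hin.le).1 hle)

end Words

/-! ### Assembling the automaton -/

theorem IsAutomatic.isDigitRecognizable_suffixPrecedes {α : Type*} [LinearOrder α] {k : ℕ}
    -- The coordinates `a`, `b`, `c`, `d` act as names of bound variables; distinctness prevents
    -- capture.
    (hk : 2 ≤ k) {x : ℕ → α} (hx : IsAutomatic k x) {ι : Type*} [DecidableEq ι] {n i j a b c d : ι}
    (hp : [a, b, c, d, n, i, j].Nodup) :
    IsDigitRecognizable k fun v => SuffixPrecedes x (v i) (v j) (v n) := by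
  have hk' : 0 < k := by omega
  have h₁ := ((isDigitRecognizable_lt hk' d b).and ((isDigitRecognizable_lt hk' d j).not.and
    (isDigitRecognizable_add_eq_add hk' c j d i))).imp
      (hx.isDigitRecognizable_rel hk (fun s t => s = t) c d)
  have h₂ := (h₁.forall_update hk' d).forall_update hk' c
  have h₃ := (isDigitRecognizable_lt hk' b n).and ((isDigitRecognizable_lt hk' b j).not.and
    ((isDigitRecognizable_add_eq_add hk' a j b i).and
      ((hx.isDigitRecognizable_rel hk (fun s t => s < t) a b).and h₂)))
  have h₄ := (h₃.exists_update hk' b).exists_update hk' a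
  simp only [List.nodup_cons, List.mem_cons, List.not_mem_nil, or_false, not_or,
    List.nodup_nil, and_true, not_false_eq_true] at hp
  obtain ⟨⟨ab, ac, ad, an, ai, aj⟩, ⟨bc, bd, bn, bi, bj⟩, ⟨cd, cn, ci, cj⟩, ⟨dn, di, dj⟩, -⟩ := hp
  simpa [Function.update_apply, ab, ac, ad, an, ai, aj, bc, bd, bn, bi, bj, cd, cn, ci, cj, dn, di,
    dj, Ne.symm ab, Ne.symm ac, Ne.symm ad, Ne.symm an, Ne.symm ai, Ne.symm aj, Ne.symm bc,
    Ne.symm bd, Ne.symm bn, Ne.symm bi, Ne.symm bj, Ne.symm cd, Ne.symm cn, Ne.symm ci, Ne.symm cj,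
    Ne.symm dn, Ne.symm di, Ne.symm dj, SuffixPrecedes] using h₄

theorem IsAutomatic.isRegular_lastTermLanguage {α : Type*} [LinearOrder α] {k : ℕ} (hk : 2 ≤ k)
    {x : ℕ → α} (hx : IsAutomatic k x) : (lastTermLanguage k x).IsRegular := by
  have hk' : 0 < k := by omega
  have : NeZero k := ⟨by omega⟩
  -- Coordinates 0, 1, 2 hold `n`, `i`, `j`, and 3 to 6 hold the bound variables of
  -- `SuffixPrecedes`.
  have h₁ : IsDigitRecognizable k fun v : Fin 7 → ℕ => SuffixPrecedes x (v 1) (v 2) (v 0) :=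
    hx.isDigitRecognizable_suffixPrecedes hk (a := 3) (b := 4) (c := 5) (d := 6) (by decide)
  have h₂ : IsDigitRecognizable k fun v : Fin 7 → ℕ => SuffixPrecedes x (v 2) (v 1) (v 0) :=
    hx.isDigitRecognizable_suffixPrecedes hk (a := 3) (b := 4) (c := 5) (d := 6) (by decide)
  have h₃ := (isDigitRecognizable_lt hk' 1 0).and
    (((((isDigitRecognizable_lt hk' 1 2).and (isDigitRecognizable_lt hk' 2 0)).imp h₁).and
      ((isDigitRecognizable_lt hk' 2 1).imp h₂.not)).forall_update hk' 2)
  have h₄ := (h₃.isRegular 0 1).inf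
    (isRegular_head_not fun d : Fin k × Fin k => (d.1 : ℕ) = 0 ∧ (d.2 : ℕ) = 0)
  convert h₄ using 1
  ext w
  constructor
  · rintro ⟨n, i, ⟨rfl, rfl, hw⟩, h⟩
    rw [exists_factorization_block_iff] at h
    refine ⟨?_, hw⟩
    change _ ∧ _
    simpa [Function.update_apply] using h
  · rintro ⟨h, hw⟩
    refine ⟨_, _, ⟨rfl, rfl, hw⟩, ?_⟩
    rw [exists_factorization_block_iff]
    change _ ∧ _ at h
    simpa [Function.update_apply] using h

end LyndonAutomatic

theorem theorem17 {α : Type*} [LinearOrder α] (k : ℕ) (hk : 2 ≤ k) (x : ℕ → α)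
    (hx : LyndonAutomatic.IsAutomatic k x) :
    ∃ (σ : Type) (_ : Finite σ) (A : DFA (Fin k × Fin k) σ),
      A.accepts = LyndonAutomatic.lastTermLanguage k x := by
  obtain ⟨σ, hσ, A, hA⟩ := hx.isRegular_lastTermLanguage hk
  exact ⟨σ, inferInstance, A, hA⟩
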